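/- All graphs are finite, undirected, without loops or multiple edges. For a graph $G$ and $S\subseteq V(G)$ let $N_G(S)$ be the set of vertices adjacent to at least one vertex of $S$, and let $$bind(G)=\min\left\{\frac{|N_G(S)|}{|S|} : \emptyset\neq S\subseteq V(G),\ N_G(S)\neq V(G)\right\}$$ be the binding number of $G$; $G$ is $1$-binding if $bind(G)\ge 1$. Let $\rho(G)$ be the largest eigenvalue of the adjacency matrix of $G$, let $\cup$ denote disjoint union of graphs, and let $G_1\vee G_2$ be the join, obtained from $G_1\cup G_2$ by joining each vertex of $G_1$ to each vertex of $G_2$. For $H: V(G)\to\{\{1\},\{0,2\}\}$ write $H^{-1}(1)=\{v\in V(G): H(v)=\{1\}\}$; an $H$-factor of $G$ is a spanning subgraph $F$ of $G$ with $d_F(v)\in H(v)$ for every $v\in V(G)$. **Theorem 1.2.** Let $G$ be a connected $1$-binding graph of order $n\ge 11$. If $$\rho(G)\ge\rho(K_1\vee(K_{n-4}\cup K_2\cup K_1)),$$ then $G$ has an $H$-factor for every $H: V(G)\to\{\{1\},\{0,2\}\}$ with $|H^{-1}(1)|$ even if and only if $G$ is not isomorphic to $K_1\vee(K_{n-4}\cup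 K_2\cup K_1)$. -/

import Mathlib

namespace SimpleGraph

/-- The join of two vertex-disjoint graphs: their disjoint union together with all edges
between the two parts. -/
def joinGraph {V W : Type*} (G : SimpleGraph V) (H : SimpleGraph W) : SimpleGraph (V ⊕ W) where
  Adj
    | Sum.inl u, Sum.inl v => G.Adj u v
    | Sum.inr u, Sum.inr v => H.Adj u v
    | Sum.inl _, Sum.inr _ => True
    | Sum.inr _, Sum.inl _ => True
  symm := ⟨by
    rintro (u | u) (v | v) h
    · exact SimpleGraph.Adj.symm (G := G) h
    · trivial
    · trivial
    · exact SimpleGraph.Adj.symm (G := H) h⟩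
  loopless := ⟨by
    rintro (u | u) h
    · exact G.irrefl h
    · exact H.irrefl h⟩

/-- The set of neighbours `N_G(S)` of a set of vertices `S`; it may meet `S`. -/
def nbhd {V : Type*} (G : SimpleGraph V) (S : Set V) : Set V :=
  {w | ∃ v ∈ S, G.Adj v w}

/-- The binding number of `G`: the minimum of `|N_G(S)| / |S|` over all nonempty sets `S` of
vertices with `N_G(S) ≠ V(G)`. For a finite graph with at least one vertex the minimum is over a
finite nonempty set (a singleton `S` qualifies). -/
noncomputable def bindingNumber {V : Type*} (G : SimpleGraph V) : ℝ :=
  sInf {x : ℝ | ∃ S : Set V, S.Nonempty ∧ G.nbhd S ≠ Set.univ ∧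
    x = ((G.nbhd S).ncard : ℝ) / (S.ncard : ℝ)}

/-- `G` is `r`-binding if its binding number is at least `r`. -/
def IsBinding {V : Type*} (r : ℝ) (G : SimpleGraph V) : Prop :=
  r ≤ G.bindingNumber

open Classical in
/-- The adjacency spectral radius of a finite graph: the largest eigenvalue of its (real
symmetric) adjacency matrix. -/
noncomputable def rho {V : Type*} [Fintype V] (G : SimpleGraph V) : ℝ :=
  sSup {x : ℝ | Module.End.HasEigenvalue (Matrix.toLin' (G.adjMatrix ℝ)) x}

/-- `F` is an `H`-factor of `G`, for a set-valued function `H` on the vertices: `F` is a spanning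
subgraph of `G` (a graph on the same vertices, with edges among those of `G`) in which the degree
of every vertex `v` belongs to `H v`. -/
def IsHFactor {V : Type*} (G : SimpleGraph V) (H : V → Set ℕ) (F : SimpleGraph V) : Prop :=
  F ≤ G ∧ ∀ v, (F.neighborSet v).ncard ∈ H v

/-- The graph `K_1 ∨ (K_{n-4} ∪ K_2 ∪ K_1)`, of order `n` for `n ≥ 4`. -/
def extremalGraph (n : ℕ) : SimpleGraph (Fin 1 ⊕ ((Fin (n - 4) ⊕ Fin 2) ⊕ Fin 1)) :=
  (completeGraph (Fin 1)).joinGraph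
    ((completeGraph (Fin (n - 4)) ⊕g completeGraph (Fin 2)) ⊕g completeGraph (Fin 1))

end SimpleGraph

/-!
# Spectral radius and `{1}`/`{0, 2}`-factors of 1-binding graphs

Every admissible `H` has a factor as soon as every vertex set `S` leaves at most `|S| + 1`
components (`exists_isHFactor_of_card_components_le`). Indeed, replace each vertex with
`H v = {0, 2}` by two adjacent copies. By parity the component bound gives Tutte's condition for this blow-up, and
a perfect matching of the blow-up projects, modulo 2, to an `H`-factor.

Suppose that a set `S` of `s` vertices leaves at least `s + 2` components. The binding condition
allows at most `s` isolated vertices among them, so that each component has at most `n - 2s - 2`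
vertices. A positive vector `y` with `A y ≤ (n - 4) y`, constant on `S` and on every component,
then bounds the spectral radius by `n - 4` (`eigenvalue_le_of_components`, with the convexity
estimate `sum_div_le`), while that of the extremal graph exceeds `n - 4`
(`lt_rho_extremalGraph`). The estimate fails only for `s = 1` and components of orders `n - 4`, `2`,
`1`; then `G` is a spanning subgraph of the extremal graph, and has smaller spectral radius if it
is a proper one (`eigenvalue_lt_of_lt`). These facts meet in `card_components_le_of_rho`.

Conversely, in the extremal graph the dominating vertex cannot have degree 1 in a factor for which
the pendant vertex and the clique `K_2` both need an edge to it
(`exists_not_isHFactor_of_iso`).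
-/

/-! ### Perfect matchings of blow-ups and factors -/

namespace SimpleGraph

/-- By parity, Tutte's condition may be violated by one: a finite graph of even order has a
perfect matching as soon as deleting any vertex set `u` leaves at most `|u| + 1` components. -/
theorem exists_isPerfectMatching_of_card_components_le {W : Type*} [Finite W] (G : SimpleGraph W)
    (heven : Even (Nat.card W))
    (h : ∀ u : Set W, Nat.card ((⊤ : G.Subgraph).deleteVerts u).coe.ConnectedComponent
      ≤ u.ncard + 1) :
    ∃ M : Subgraph G, M.IsPerfectMatching := by
  rw [tutte]
  intro u hu
  unfold IsTutteViolator at hu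
  have hle : ((⊤ : G.Subgraph).deleteVerts u).coe.oddComponents.ncard ≤ u.ncard + 1 :=
    (Set.ncard_le_card _).trans (h u)
  have hpar := odd_ncard_oddComponents ((⊤ : G.Subgraph).deleteVerts u).coe
  have hcard : Nat.card ((⊤ : G.Subgraph).deleteVerts u).verts + u.ncard = Nat.card W := by
    have : ((⊤ : G.Subgraph).deleteVerts u).verts = uᶜ := by
      ext x; simp
    rw [this, Nat.card_coe_set_eq, add_comm]
    exact Set.ncard_add_ncard_compl u
  have heq : ((⊤ : G.Subgraph).deleteVerts u).coe.oddComponents.ncard = u.ncard + 1 := by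
    omega
  rw [heq] at hpar
  rw [← hcard] at heven
  rw [Nat.even_add] at heven
  rw [Nat.odd_add_one, ← Nat.not_even_iff_odd, not_not, ← Nat.not_even_iff_odd] at hpar
  tauto

/-- The vertex of `G` of which a vertex of `G.blowUp B` is a copy. -/
def blowUpProj {V : Type*} (B : Set V) : V ⊕ B → V := Sum.elim id Subtype.val

/-- The graph obtained from `G` by replacing every vertex of `B` by two adjacent copies, the
second one being its copy in the right summand: copies of distinct vertices are adjacent if and
only if these are. -/
def blowUp {V : Type*} (G : SimpleGraph V) (B : Set V) : SimpleGraph (V ⊕ B) where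
  Adj p q := p ≠ q ∧ (blowUpProj B p = blowUpProj B q ∨ G.Adj (blowUpProj B p) (blowUpProj B q))
  symm := ⟨fun _ _ h => ⟨h.1.symm, h.2.imp Eq.symm fun h => h.symm⟩⟩
  loopless := ⟨fun _ h => h.1 rfl⟩

/-- A set `u` of copies separates the blow-up no more than the set of the vertices all of whose
copies lie in `u` separates `G`. -/
theorem card_components_blowUp_le {V : Type*} [Finite V] (G : SimpleGraph V) (B : Set V)
    (u : Set (V ⊕ B)) :
    ∃ S : Set V, S.ncard ≤ u.ncard ∧
      Nat.card ((⊤ : (G.blowUp B).Subgraph).deleteVerts u).coe.ConnectedComponent ≤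
        Nat.card (G.induce Sᶜ).ConnectedComponent := by
  refine ⟨{v | ∀ p, blowUpProj B p = v → p ∈ u}, ?_, ?_⟩
  · refine Set.ncard_le_ncard_of_injOn Sum.inl (fun v hv => hv (Sum.inl v) rfl)
      Sum.inl_injective.injOn
  · have hex : ∀ v : ({v | ∀ p, blowUpProj B p = v → p ∈ u}ᶜ : Set V),
        ∃ p, blowUpProj B p = v ∧ p ∉ u := by
      rintro ⟨v, hv⟩
      by_contra! hcon
      exact hv hcon
    choose σ hσ hσu using hex
    let φ : G.induce ({v | ∀ p, blowUpProj B p = v → p ∈ u}ᶜ : Set V) →g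
        ((⊤ : (G.blowUp B).Subgraph).deleteVerts u).coe :=
      { toFun := fun v => ⟨σ v, by simpa using hσu v⟩
        map_rel' := by
          intro a b hab
          have hab' : G.Adj a b := hab
          simp only [Subgraph.coe_adj, Subgraph.deleteVerts_adj, Subgraph.verts_top, Set.mem_univ,
            Subgraph.top_adj, true_and]
          refine ⟨hσu a, hσu b, fun h => hab'.ne ?_, Or.inr ?_⟩
          · rw [← hσ a, ← hσ b, h]
          · rw [hσ a, hσ b]; exact hab' }
    refine Nat.card_le_card_of_surjective (ConnectedComponent.map φ) ?_
    intro c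
    induction c using ConnectedComponent.ind with
    | h p =>
      obtain ⟨p, hp⟩ := p
      have hpu : p ∉ u := by simpa using hp
      have hmem : blowUpProj B p ∈ ({v | ∀ p, blowUpProj B p = v → p ∈ u}ᶜ : Set V) :=
        fun h => hpu (h p rfl)
      refine ⟨(G.induce _).connectedComponentMk ⟨blowUpProj B p, hmem⟩, ?_⟩
      rw [ConnectedComponent.map_mk, ConnectedComponent.eq]
      by_cases hpe : σ ⟨blowUpProj B p, hmem⟩ = p
      · have : φ ⟨blowUpProj B p, hmem⟩ = ⟨p, hp⟩ := Subtype.ext hpe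
        rw [this]
      · refine Adj.reachable ?_
        simp only [Subgraph.coe_adj, Subgraph.deleteVerts_adj, Subgraph.verts_top, Set.mem_univ,
            Subgraph.top_adj, true_and]
        exact ⟨hσu _, hpu, hpe, Or.inl (hσ _)⟩

/-- A perfect matching of the blow-up projects to a factor: keep the edges of `G` covered by an
odd number of matching edges. A pair of parallel matching edges joins two vertices of `B`, whose
degrees then both become `0`. -/
theorem exists_isHFactor_of_isPerfectMatching {V : Type*} [Finite V] (G : SimpleGraph V)
    (H : V → Set ℕ) (hH : ∀ v, H v = {1} ∨ H v = {0, 2})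
    (M : (G.blowUp {v | H v ≠ {1}}).Subgraph) (hM : M.IsPerfectMatching) :
    ∃ F : SimpleGraph V, G.IsHFactor H F := by
  classical
  set B : Set V := {v | H v ≠ {1}} with hB
  have := Fintype.ofFinite V
  rw [Subgraph.isPerfectMatching_iff] at hM
  choose m hm hmu using hM
  have hmm : ∀ p, m (m p) = p := fun p => (hmu (m p) p (hm p).symm).symm
  have hadj : ∀ p, (G.blowUp B).Adj p (m p) := fun p => (hm p).adj_sub
  set P := blowUpProj B with hP
  let X : V → V → Finset (V ⊕ B) := fun u v =>
    Finset.univ.filter fun p => P p = u ∧ P (m p) = v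
  have hX : ∀ u v, (X u v).card = (X v u).card := by
    intro u v
    refine Finset.card_bij (fun p _ => m p) ?_ ?_ ?_
    · intro p hp
      simp only [X, Finset.mem_filter, Finset.mem_univ, true_and] at hp ⊢
      rw [hmm]; exact hp.symm
    · intro p _ q _ h
      rw [← hmm p, h, hmm]
    · intro p hp
      simp only [X, Finset.mem_filter, Finset.mem_univ, true_and] at hp ⊢
      exact ⟨m p, ⟨hp.2, by rw [hmm]; exact hp.1⟩, hmm p⟩
  let F : SimpleGraph V :=
    { Adj := fun u v => u ≠ v ∧ Odd (X u v).card
      symm := ⟨fun u v h => ⟨h.1.symm, by rw [hX]; exact h.2⟩⟩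
      loopless := ⟨fun _ h => h.1 rfl⟩ }
  refine ⟨F, ?_, ?_⟩
  · intro u v h
    obtain ⟨p, hp⟩ := Finset.card_pos.1 h.2.pos
    simp only [X, Finset.mem_filter, Finset.mem_univ, true_and] at hp
    rcases (hadj p).2 with h' | h'
    · exact absurd (hp.1.symm.trans (h'.trans hp.2)) h.1
    · rw [← hp.1, ← hp.2]; exact h'
  · intro v
    by_cases hv : H v = {1}
    · -- the only copy of `v` is `Sum.inl v`
      have hcopy : ∀ p, P p = v ↔ p = Sum.inl v := by
        rintro (p | ⟨p, hp⟩)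
        · simp [hP, blowUpProj]
        · simp only [hP, blowUpProj, Sum.elim_inr, reduceCtorEq, iff_false]
          rintro rfl
          exact hp hv
      have hne : v ≠ P (m (Sum.inl v)) := fun h =>
        (hadj (Sum.inl v)).ne ((hcopy _).1 h.symm).symm
      have hXv : ∀ w, X v w = if w = P (m (Sum.inl v)) then {Sum.inl v} else ∅ := by
        intro w
        ext p
        simp only [X, Finset.mem_filter, Finset.mem_univ, true_and, hcopy]
        split_ifs with h
        · simp only [Finset.mem_singleton]
          exact ⟨fun h => h.1, fun h' => ⟨h', by rw [h', h]⟩⟩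
        · simp only [Finset.notMem_empty, iff_false]
          rintro ⟨rfl, h'⟩
          exact h h'.symm
      have : F.neighborSet v = {P (m (Sum.inl v))} := by
        ext w
        simp only [mem_neighborSet, F, hXv, Set.mem_singleton_iff]
        split_ifs with h
        · simp [h, hne]
        · simp [h]
      rw [this, hv]
      simp
    · have hvB : v ∈ B := hv
      have hHv : H v = {0, 2} := (hH v).resolve_left hv
      have hcopy : ∀ p, P p = v ↔ p = Sum.inl v ∨ p = Sum.inr ⟨v, hvB⟩ := by
        rintro (p | ⟨p, hp⟩)
        · simp [hP, blowUpProj]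
        · simp [hP, blowUpProj]
      set a := P (m (Sum.inl v)) with ha
      set b := P (m (Sum.inr ⟨v, hvB⟩)) with hb
      have hXv : ∀ w, (X v w).card = (if w = a then 1 else 0) + (if w = b then 1 else 0) := by
        intro w
        have : X v w = (if w = a then {Sum.inl v} else ∅) ∪
            (if w = b then {Sum.inr ⟨v, hvB⟩} else ∅) := by
          ext p
          simp only [X, Finset.mem_filter, Finset.mem_univ, true_and, hcopy, Finset.mem_union]
          constructor
          · rintro ⟨rfl | rfl, h⟩
            · left; rw [if_pos h.symm]; simp
            · right; rw [if_pos h.symm]; simp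
          · rintro (h | h)
            · split_ifs at h with h'
              · rw [Finset.mem_singleton] at h
                exact ⟨Or.inl h, by rw [h, h']⟩
              · simp at h
            · split_ifs at h with h'
              · rw [Finset.mem_singleton] at h
                exact ⟨Or.inr h, by rw [h, h']⟩
              · simp at h
        rw [this, Finset.card_union_of_disjoint]
        · split_ifs <;> simp
        · split_ifs <;> simp
      rw [hHv]
      by_cases hab : a = b
      · have : F.neighborSet v = ∅ := by
          ext w
          simp only [mem_neighborSet, F, hXv, hab, Set.mem_empty_iff_false, iff_false]
          rintro ⟨-, h⟩
          split_ifs at h <;> revert h <;> decide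
        rw [this]; simp
      · -- neither copy is matched to the other one, as otherwise `a = v = b`
        have hav : a ≠ v := by
          intro h
          rcases (hcopy _).1 h with h' | h'
          · exact (hadj (Sum.inl v)).ne h'.symm
          · apply hab
            rw [h, hb, ← h', hmm]; rfl
        have hbv : b ≠ v := by
          intro h
          rcases (hcopy _).1 h with h' | h'
          · apply hab
            rw [h, ha, ← h', hmm]; rfl
          · exact (hadj (Sum.inr ⟨v, hvB⟩)).ne h'.symm
        have : F.neighborSet v = {a, b} := by
          ext w
          simp only [mem_neighborSet, F, hXv, Set.mem_insert_iff, Set.mem_singleton_iff]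
          by_cases h1 : w = a
          · subst h1; simp [hab, Ne.symm hav]
          · by_cases h2 : w = b
            · subst h2; simp [Ne.symm hab, Ne.symm hbv]
            · simp [h1, h2]
        rw [this, Set.ncard_pair hab]; simp

/-- The hypothesis is tight: if `k` vertices leave at least `k + 2` components, then prescribing the
degree `1` at suitable vertices admits no factor. -/
theorem exists_isHFactor_of_card_components_le {V : Type*} [Finite V] (G : SimpleGraph V)
    (hG : ∀ S : Set V, Nat.card (G.induce Sᶜ).ConnectedComponent ≤ S.ncard + 1)
    (H : V → Set ℕ) (hH : ∀ v, H v = {1} ∨ H v = {0, 2}) (heven : Even {v | H v = {1}}.ncard) :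
    ∃ F : SimpleGraph V, G.IsHFactor H F := by
  obtain ⟨M, hM⟩ := exists_isPerfectMatching_of_card_components_le (G.blowUp {v | H v ≠ {1}}) (by
    have h : {v | H v = {1}}.ncard + {v | H v ≠ {1}}.ncard = Nat.card V :=
      Set.ncard_add_ncard_compl {v | H v = {1}}
    rw [Nat.card_sum, Nat.card_coe_set_eq, ← h, add_assoc, ← two_mul]
    exact heven.add (even_two_mul _)) (fun u => by
    obtain ⟨S, hS, h⟩ := card_components_blowUp_le G {v | H v ≠ {1}} u
    exact (h.trans (hG S)).trans (by omega))
  exact exists_isHFactor_of_isPerfectMatching G H hH M hM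

/-! ### The extremal graph -/

/-- An index of the cliques `K_1`, `K_{n-4}`, `K_2`, `K_1` of which `extremalGraph n` is made; the
index of the dominating vertex is `0`. -/
def extremalPart (n : ℕ) : Fin 1 ⊕ ((Fin (n - 4) ⊕ Fin 2) ⊕ Fin 1) → Fin 4 :=
  Sum.elim (fun _ => 0) (Sum.elim (Sum.elim (fun _ => 1) (fun _ => 2)) (fun _ => 3))

theorem extremalGraph_adj (n : ℕ) (p q : Fin 1 ⊕ ((Fin (n - 4) ⊕ Fin 2) ⊕ Fin 1)) :
    (extremalGraph n).Adj p q ↔ p ≠ q ∧ (extremalPart n p = 0 ∨ extremalPart n q = 0 ∨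
      extremalPart n p = extremalPart n q) := by
  rcases p with p | (p | p) | p <;> rcases q with q | (q | q) | q <;>
    simp [extremalGraph, joinGraph, extremalPart]

/-- No factor has degree `1` at the dominating vertex, at the pendant vertex and at exactly one
vertex of the clique `K_2`: the only edge at the dominating vertex would go to the pendant vertex,
leaving a single edge for `K_2`. -/
theorem exists_not_isHFactor_of_iso {V : Type*} [Finite V] (G : SimpleGraph V) (n : ℕ)
    (hn : 5 ≤ n) (e : G ≃g extremalGraph n) :
    ∃ H : V → Set ℕ, (∀ v, H v = {1} ∨ H v = {0, 2}) ∧ Even {v | H v = {1}}.ncard ∧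
      ∀ F : SimpleGraph V, ¬ G.IsHFactor H F := by
  classical
  have h12 : ({0, 2} : Set ℕ) ≠ {1} := fun h => by
    have : (0 : ℕ) ∈ ({1} : Set ℕ) := h ▸ by simp
    simp at this
  let h := e.symm (Sum.inl 0)
  let x := e.symm (Sum.inr (Sum.inl (Sum.inl ⟨0, by omega⟩)))
  let a := e.symm (Sum.inr (Sum.inl (Sum.inr 0)))
  let b := e.symm (Sum.inr (Sum.inl (Sum.inr 1)))
  let p := e.symm (Sum.inr (Sum.inr 0))
  let A : Finset V := {h, x, a, p}
  have hsurj : ∀ v : V, ∃ q, v = e.symm q := fun v => ⟨e v, by simp⟩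
  have hadj : ∀ q r, G.Adj (e.symm q) (e.symm r) ↔ (extremalGraph n).Adj q r :=
    fun q r => e.symm.map_adj_iff
  refine ⟨fun v => if v ∈ A then {1} else {0, 2}, ?_, ?_, ?_⟩
  · intro v
    simp only
    split_ifs <;> simp
  · have : {v | (if v ∈ A then ({1} : Set ℕ) else {0, 2}) = {1}} = (A : Set V) := by
      ext v
      simp only [Set.mem_ofPred_eq, Finset.mem_coe]
      split_ifs with hv
      · simp [hv]
      · simp [hv, h12]
    rw [this, Set.ncard_coe_finset]
    have : A.card = 4 := by
      simp [A, h, x, a, p]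
    rw [this]; decide
  · rintro F ⟨hFG, hF⟩
    have hone : ∀ v ∈ A, ∃ w, F.neighborSet v = {w} := by
      intro v hv
      have := hF v
      simp only [if_pos hv] at this
      exact Set.ncard_eq_one.1 this
    -- `p ~ h` in `F`
    have hph : F.Adj p h := by
      obtain ⟨w, hw⟩ := hone p (by simp [A])
      have hpw : F.Adj p w := by rw [← mem_neighborSet, hw]; rfl
      have hG := hFG hpw
      obtain ⟨q, rfl⟩ := hsurj w
      rw [hadj, extremalGraph_adj] at hG
      rcases q with q | (q | q) | q
      · rwa [Subsingleton.elim q 0] at hpw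
      · simp [extremalPart] at hG
      · simp [extremalPart] at hG
      · simp [Subsingleton.elim q 0] at hG
    have hh : ∀ w, F.Adj w h → w = p := by
      obtain ⟨w', hw'⟩ := hone h (by simp [A])
      intro w hw
      have h1 : w ∈ F.neighborSet h := hw.symm
      have h2 : p ∈ F.neighborSet h := hph.symm
      rw [hw'] at h1 h2
      exact h1.trans h2.symm
    have hab : F.Adj a b := by
      obtain ⟨w, hw⟩ := hone a (by simp [A])
      have haw : F.Adj a w := by rw [← mem_neighborSet, hw]; rfl
      have hG := hFG haw
      obtain ⟨q, rfl⟩ := hsurj w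
      rw [hadj, extremalGraph_adj] at hG
      rcases q with q | (q | q) | q
      · rw [Subsingleton.elim q 0] at haw
        have := hh a haw
        simp [a, p] at this
      · simp [extremalPart] at hG
      · fin_cases q
        · simp at hG
        · exact haw
      · simp [extremalPart] at hG
    have hb : F.neighborSet b = {a} := by
      ext w
      simp only [mem_neighborSet, Set.mem_singleton_iff]
      constructor
      · intro hbw
        have hG := hFG hbw
        obtain ⟨q, rfl⟩ := hsurj w
        rw [hadj, extremalGraph_adj] at hG
        rcases q with q | (q | q) | q
        · rw [Subsingleton.elim q 0] at hbw
          have := hh b hbw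
          simp [b, p] at this
        · simp [extremalPart] at hG
        · fin_cases q
          · rfl
          · simp at hG
        · simp [extremalPart] at hG
      · rintro rfl
        exact hab.symm
    have hbA : b ∉ A := by simp [A, h, x, a, b, p]
    have := hF b
    simp [hb, hbA] at this

/-! ### Eigenvalues and positive test vectors -/

open Classical in
theorem hasEigenvalue_adjMatrix_iff {V : Type*} [Fintype V] (G : SimpleGraph V) (x : ℝ) :
    Module.End.HasEigenvalue (Matrix.toLin' (G.adjMatrix ℝ)) x ↔
      ∃ z : V → ℝ, z ≠ 0 ∧ ∀ v, ∑ u, (if G.Adj v u then z u else 0) = x * z v := by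
  have key : ∀ z : V → ℝ, Matrix.toLin' (G.adjMatrix ℝ) z = x • z ↔
      ∀ v, ∑ u, (if G.Adj v u then z u else 0) = x * z v := by
    intro z
    rw [Matrix.toLin'_apply, funext_iff]
    refine forall_congr' fun v => ?_
    simp [Matrix.mulVec, dotProduct, adjMatrix_apply]
  constructor
  · intro h
    obtain ⟨z, hz⟩ := h.exists_hasEigenvector
    exact ⟨z, hz.2, (key z).1 hz.apply_eq_smul⟩
  · rintro ⟨z, hz, h⟩
    exact Module.End.hasEigenvalue_of_hasEigenvector
      ⟨Module.End.mem_eigenspace_iff.2 ((key z).2 h), hz⟩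

open Classical in
theorem finite_eigenvalues {V : Type*} [Fintype V] (G : SimpleGraph V) :
    {x : ℝ | Module.End.HasEigenvalue (Matrix.toLin' (G.adjMatrix ℝ)) x}.Finite :=
  Module.End.finite_hasEigenvalue _

open Classical in
theorem le_rho {V : Type*} [Fintype V] (G : SimpleGraph V) {x : ℝ} {z : V → ℝ} (hz : z ≠ 0)
    (h : ∀ v, ∑ u, (if G.Adj v u then z u else 0) = x * z v) : x ≤ G.rho :=
  le_csSup G.finite_eigenvalues.bddAbove ((hasEigenvalue_adjMatrix_iff G x).2 ⟨z, hz, h⟩)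

open Classical in
/-- Positivity of the bound matters only if there is no eigenvalue at all. -/
theorem rho_lt {V : Type*} [Fintype V] (G : SimpleGraph V) {r : ℝ} (hr : 0 < r)
    (h : ∀ (x : ℝ) (z : V → ℝ), z ≠ 0 →
      (∀ v, ∑ u, (if G.Adj v u then z u else 0) = x * z v) → x < r) : G.rho < r := by
  rcases Set.eq_empty_or_nonempty
    {x : ℝ | Module.End.HasEigenvalue (Matrix.toLin' (G.adjMatrix ℝ)) x} with he | hne
  · rw [rho, he, Real.sSup_empty]
    exact hr
  · obtain ⟨z, hz, hzx⟩ := (hasEigenvalue_adjMatrix_iff G _).1 (hne.csSup_mem G.finite_eigenvalues)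
    exact h _ z hz hzx

theorem exists_extremal_ratio {V : Type*} [Finite V] {y z : V → ℝ} (hy : ∀ v, 0 < y v)
    (hz : z ≠ 0) : ∃ t : ℝ, 0 < t ∧ (∀ u, |z u| ≤ t * y u) ∧ ∃ v, |z v| = t * y v := by
  obtain ⟨w, hw⟩ := Function.ne_iff.1 hz
  have : Nonempty V := ⟨w⟩
  obtain ⟨v, hv⟩ := Finite.exists_max fun u => |z u| / y u
  refine ⟨|z v| / y v, ?_, fun u => ?_, v, ?_⟩
  · exact lt_of_lt_of_le (div_pos (abs_pos.2 hw) (hy w)) (hv w)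
  · exact (div_le_iff₀ (hy u)).1 (hv u)
  · rw [div_mul_cancel₀ _ (hy v).ne']

open Classical in
/-- A positive vector `y` with `A y ≤ x y` bounds the eigenvalues of the adjacency matrix `A`. -/
theorem eigenvalue_le_of_positive {V : Type*} [Fintype V] (G : SimpleGraph V) {x : ℝ} {y : V → ℝ}
    (hy : ∀ v, 0 < y v) (hxy : ∀ v, ∑ u, (if G.Adj v u then y u else 0) ≤ x * y v)
    {l : ℝ} {z : V → ℝ} (hz : z ≠ 0)
    (hl : ∀ v, ∑ u, (if G.Adj v u then z u else 0) = l * z v) : l ≤ x := by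
  obtain ⟨t, ht, hzt, v, hv⟩ := exists_extremal_ratio hy hz
  have h1 : l * (t * y v) ≤ t * (x * y v) :=
    calc l * (t * y v) ≤ |l * z v| := by
          rw [abs_mul, hv]
          exact mul_le_mul_of_nonneg_right (le_abs_self l) (mul_pos ht (hy v)).le
      _ = |∑ u, (if G.Adj v u then z u else 0)| := by rw [hl]
      _ ≤ ∑ u, |if G.Adj v u then z u else 0| := Finset.abs_sum_le_sum_abs _ _
      _ ≤ ∑ u, t * (if G.Adj v u then y u else 0) := by
          refine Finset.sum_le_sum fun u _ => ?_
          split_ifs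
          · exact hzt u
          · simp
      _ = t * ∑ u, (if G.Adj v u then y u else 0) := by rw [Finset.mul_sum]
      _ ≤ t * (x * y v) := mul_le_mul_of_nonneg_left (hxy v) ht.le
  refine le_of_mul_le_mul_right ?_ (mul_pos ht (hy v))
  linarith

open Classical in
/-- Strict monotonicity of the spectral radius: if `E` has a positive eigenvector for `r`, then
all eigenvalues of a connected proper spanning subgraph are less than `r`. -/
theorem eigenvalue_lt_of_lt {V : Type*} [Fintype V] {G E : SimpleGraph V} (hGE : G < E)
    (hG : G.Connected) {r : ℝ} {y : V → ℝ} (hy : ∀ v, 0 < y v)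
    (hry : ∀ v, ∑ u, (if E.Adj v u then y u else 0) = r * y v)
    {l : ℝ} {z : V → ℝ} (hz : z ≠ 0)
    (hl : ∀ v, ∑ u, (if G.Adj v u then z u else 0) = l * z v) : l < r := by
  by_contra! hlr
  obtain ⟨t, ht, hzt, v₀, hv₀⟩ := exists_extremal_ratio hy hz
  -- where `|z| / y` is maximal, equality holds in all the estimates of `|l z v|`
  have hstep : ∀ v, |z v| = t * y v → ∀ u, E.Adj v u → G.Adj v u ∧ |z u| = t * y u := by
    intro v hv
    have hterm : ∀ u ∈ Finset.univ, |if G.Adj v u then z u else 0| ≤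
        t * (if E.Adj v u then y u else 0) := by
      intro u _
      by_cases h : G.Adj v u
      · rw [if_pos h, if_pos (hGE.le h)]
        exact hzt u
      · rw [if_neg h, abs_zero]
        split_ifs
        · exact (mul_pos ht (hy u)).le
        · simp
    have hge : ∑ u, t * (if E.Adj v u then y u else 0) ≤
        ∑ u, |if G.Adj v u then z u else 0| :=
      calc ∑ u, t * (if E.Adj v u then y u else 0) = r * (t * y v) := by
            rw [← Finset.mul_sum, hry]; ring
        _ ≤ l * (t * y v) := mul_le_mul_of_nonneg_right hlr (mul_pos ht (hy v)).le
        _ ≤ |l * z v| := by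
            rw [abs_mul, hv]
            exact mul_le_mul_of_nonneg_right (le_abs_self l) (mul_pos ht (hy v)).le
        _ = |∑ u, (if G.Adj v u then z u else 0)| := by rw [hl]
        _ ≤ _ := Finset.abs_sum_le_sum_abs _ _
    have heq := (Finset.sum_eq_sum_iff_of_le hterm).1 (le_antisymm (Finset.sum_le_sum hterm) hge)
    intro u hu
    have h := heq u (Finset.mem_univ u)
    rw [if_pos hu] at h
    by_cases hGu : G.Adj v u
    · rw [if_pos hGu] at h
      exact ⟨hGu, h⟩
    · rw [if_neg hGu, abs_zero] at h
      exact absurd h (mul_pos ht (hy u)).ne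
  have hall : ∀ v, |z v| = t * y v := by
    intro v
    obtain ⟨w⟩ := hG.preconnected v v₀
    induction w with
    | nil => exact hv₀
    | cons h _ ih =>
      exact (hstep _ (ih hv₀) _ (hGE.le h).symm).2
  exact hGE.not_ge fun v u h => (hstep v (hall v) u h).1

/-! ### The spectral radius of the extremal graph -/

theorem exists_root_quotient_equation {n : ℝ} (hn : 11 ≤ n) :
    ∃ r : ℝ, n - 4 < r ∧ r = (n - 4) / (r - (n - 5)) + 2 / (r - 1) + 1 / r := by
  let f : ℝ → ℝ := fun r => r - ((n - 4) / (r - (n - 5)) + 2 / (r - 1) + 1 / r)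
  have hcont : ContinuousOn f (Set.Icc (n - 4) n) := by
    have h1 : ∀ r ∈ Set.Icc (n - 4) n, r - (n - 5) ≠ 0 := fun r hr => by
      have := hr.1; linarith
    have h2 : ∀ r ∈ Set.Icc (n - 4) n, r - 1 ≠ 0 := fun r hr => by
      have := hr.1; linarith
    have h3 : ∀ r ∈ Set.Icc (n - 4) n, r ≠ 0 := fun r hr => by
      have := hr.1; linarith
    fun_prop (disch := assumption)
  have hlo : f (n - 4) < 0 := by
    have h1 : n - 4 - (n - 5) = 1 := by ring
    have h2 : 0 < 2 / (n - 4 - 1) := div_pos two_pos (by linarith)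
    have h3 : 0 < 1 / (n - 4) := div_pos one_pos (by linarith)
    simp only [f, h1, div_one]
    linarith
  have hhi : 0 < f n := by
    have h1 : (n - 4) / (n - (n - 5)) = (n - 4) / 5 := by congr 1; ring
    have h2 : 2 / (n - 1) ≤ 1 := (div_le_one (by linarith)).2 (by linarith)
    have h3 : 1 / n ≤ 1 := (div_le_one (by linarith)).2 (by linarith)
    simp only [f, h1]
    linarith
  obtain ⟨r, hr, h0⟩ := intermediate_value_Icc (by linarith) hcont ⟨hlo.le, hhi.le⟩
  refine ⟨r, lt_of_le_of_ne hr.1 ?_, by simp only [f] at h0; linarith⟩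
  rintro rfl
  exact hlo.ne h0

theorem sum_ne_ite {m : ℕ} (p : Fin m) (c : ℝ) :
    ∑ q : Fin m, (if p ≠ q then c else 0) = ((m : ℝ) - 1) * c := by
  have h : ∀ q : Fin m, (if p ≠ q then c else 0) = c - (if p = q then c else 0) := by
    intro q; split_ifs <;> simp_all
  simp only [h, Finset.sum_sub_distrib, Finset.sum_ite_eq, Finset.mem_univ, if_true,
    Finset.sum_const, Finset.card_univ, Fintype.card_fin, nsmul_eq_mul]
  ring

open Classical in
/-- The Perron vector of the extremal graph, normalized to `1` at the dominating vertex. -/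
theorem exists_extremalGraph_eigenvector {n : ℕ} (hn : 11 ≤ n) :
    ∃ (r : ℝ) (y : Fin 1 ⊕ ((Fin (n - 4) ⊕ Fin 2) ⊕ Fin 1) → ℝ), (n : ℝ) - 4 < r ∧
      (∀ p, 0 < y p) ∧
      ∀ p, ∑ q, (if (extremalGraph n).Adj p q then y q else 0) = r * y p := by
  have hnR : (11 : ℝ) ≤ n := by exact_mod_cast hn
  obtain ⟨r, hr, heq⟩ := exists_root_quotient_equation hnR
  have h1 : 0 < r - (n - 5) := by linarith
  have h2 : 0 < r - 1 := by linarith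
  have h3 : 0 < r := by linarith
  have hcast : ((n - 4 : ℕ) : ℝ) = n - 4 := by rw [Nat.cast_sub (by omega)]; norm_num
  refine ⟨r, Sum.elim (fun _ => 1) (Sum.elim (Sum.elim (fun _ => 1 / (r - (n - 5)))
    (fun _ => 1 / (r - 1))) (fun _ => 1 / r)), hr, ?_, ?_⟩
  · rintro (p | (p | p) | p)
    · exact one_pos
    · exact one_div_pos.2 h1
    · exact one_div_pos.2 h2
    · exact one_div_pos.2 h3
  · simp only [extremalGraph_adj, Fintype.sum_sum_type]
    rintro (p | (p | p) | p)
    · simp [extremalPart, Subsingleton.elim p 0, hcast]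
      rw [div_eq_mul_inv, div_eq_mul_inv, one_div] at heq
      linarith
    · have := sum_ne_ite p ((r - (n - 5))⁻¹)
      simp [extremalPart, hcast] at this ⊢
      rw [this]
      field_simp
      ring
    · have := sum_ne_ite p ((r - 1)⁻¹)
      simp [extremalPart, -Fin.sum_univ_two] at this ⊢
      rw [this]
      field_simp
      ring
    · simp [extremalPart, Subsingleton.elim p 0, h3.ne']

theorem lt_rho_extremalGraph {n : ℕ} (hn : 11 ≤ n) : (n : ℝ) - 4 < (extremalGraph n).rho := by
  classical
  obtain ⟨r, y, hr, hy, h⟩ := exists_extremalGraph_eigenvector hn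
  exact hr.trans_le (le_rho _ (fun h0 => (hy (Sum.inl 0)).ne' (congrFun h0 _))
    fun v => by convert h v)

/-! ### Components left by a separating set -/

theorem ncard_le_ncard_nbhd {V : Type*} [Finite V] {G : SimpleGraph V} (hG : G.IsBinding 1)
    {I : Set V} (hI : G.nbhd I ≠ Set.univ) : I.ncard ≤ (G.nbhd I).ncard := by
  rcases I.eq_empty_or_nonempty with rfl | hne
  · simp
  · have hpos : (0 : ℝ) < I.ncard := by exact_mod_cast (Set.ncard_pos).2 hne
    have h : (1 : ℝ) ≤ (G.nbhd I).ncard / I.ncard := by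
      refine le_trans hG (csInf_le ⟨0, ?_⟩ ⟨I, hne, hI, rfl⟩)
      rintro _ ⟨S, -, -, rfl⟩
      positivity
    rw [le_div_iff₀ hpos, one_mul] at h
    exact_mod_cast h

/-- The isolated vertices of `G - S` have all their neighbours in `S`. -/
theorem card_isolated_components_le {V : Type*} [Finite V] {G : SimpleGraph V}
    (hG : G.IsBinding 1) {S : Set V} (hS : S ≠ Set.univ) :
    {c : (G.induce Sᶜ).ConnectedComponent | c.supp.ncard = 1}.ncard ≤ S.ncard := by
  set K := {c : (G.induce Sᶜ).ConnectedComponent | c.supp.ncard = 1} with hK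
  have hex : ∀ c : (G.induce Sᶜ).ConnectedComponent, ∃ v, (G.induce Sᶜ).connectedComponentMk v = c :=
    fun c => c.exists_rep
  choose v hv using hex
  let I : Set V := (fun c => (v c : V)) '' K
  have hinj : Function.Injective fun c => (v c : V) := fun c d h => by
    rw [← hv c, ← hv d, Subtype.ext h]
  have hsub : G.nbhd I ⊆ S := by
    rintro w ⟨_, ⟨c, hc, rfl⟩, hw⟩
    by_contra hwS
    obtain ⟨a, ha⟩ := Set.ncard_eq_one.1 (show c.supp.ncard = 1 from hc)
    have h1 : v c ∈ c.supp := hv c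
    have h2 : (⟨w, hwS⟩ : (Sᶜ : Set V)) ∈ c.supp := by
      rw [ConnectedComponent.mem_supp_iff]
      refine Eq.trans ?_ (hv c)
      have hadj : (G.induce Sᶜ).Adj (v c) ⟨w, hwS⟩ := hw
      exact ConnectedComponent.eq.2 hadj.reachable.symm
    rw [ha] at h1 h2
    have h3 : v c = ⟨w, hwS⟩ := h1.trans h2.symm
    exact hw.ne (congrArg Subtype.val h3)
  calc K.ncard = I.ncard := (Set.ncard_image_of_injective K hinj).symm
    _ ≤ (G.nbhd I).ncard := ncard_le_ncard_nbhd hG fun h => hS (Set.univ_subset_iff.1 (h ▸ hsub))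
    _ ≤ S.ncard := Set.ncard_le_ncard hsub

theorem sum_ncard_supp {V : Type*} [Finite V] (G : SimpleGraph V)
    [Fintype G.ConnectedComponent] : ∑ c : G.ConnectedComponent, c.supp.ncard = Nat.card V := by
  classical
  have := Fintype.ofFinite V
  rw [Nat.card_eq_fintype_card, ← Finset.card_univ,
    Finset.card_eq_sum_card_fiberwise (f := G.connectedComponentMk) (t := Finset.univ) (by simp)]
  refine Finset.sum_congr rfl fun c _ => ?_
  rw [← Set.ncard_coe_finset]
  congr 1
  ext v
  simp [ConnectedComponent.mem_supp_iff]

theorem two_mul_card_le_sum_add {K : Type*} (t : Finset K) (f : K → ℕ) (hf : ∀ c, 1 ≤ f c) :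
    2 * t.card ≤ ∑ c ∈ t, f c + (t.filter fun c => f c = 1).card := by
  rw [Finset.card_filter, ← Finset.sum_add_distrib, mul_comm, ← smul_eq_mul,
    ← Finset.sum_const]
  refine Finset.sum_le_sum fun c _ => ?_
  have := hf c
  split_ifs <;> omega

/-! ### Spectral bound from a separating set -/

open Classical in
/-- The test vector is `1` on `S` and `|S| / (x + 1 - c)` on a component of `G - S` with `c`
vertices; these are the values for which, if `G` has all possible edges, equality holds outside
`S`. -/
theorem eigenvalue_le_of_components {V : Type*} [Fintype V] (G : SimpleGraph V) {S : Set V}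
    (hS : S.Nonempty) [Fintype (G.induce Sᶜ).ConnectedComponent] {x : ℝ}
    (hx : ∀ c : (G.induce Sᶜ).ConnectedComponent, (c.supp.ncard : ℝ) < x + 1)
    (hsum : (S.ncard : ℝ) - 1 + S.ncard * ∑ c : (G.induce Sᶜ).ConnectedComponent,
      (c.supp.ncard : ℝ) / (x + 1 - c.supp.ncard) ≤ x)
    {l : ℝ} {z : V → ℝ} (hz : z ≠ 0)
    (hl : ∀ v, ∑ u, (if G.Adj v u then z u else 0) = l * z v) : l ≤ x := by
  have hs : (0 : ℝ) < S.ncard := by exact_mod_cast (Set.ncard_pos).2 hS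
  let g : (Sᶜ : Set V) → ℝ := fun u =>
    S.ncard / (x + 1 - ((G.induce Sᶜ).connectedComponentMk u).supp.ncard)
  have hg : ∀ u, 0 < g u := fun u => div_pos hs (sub_pos.2 (hx _))
  let y : V → ℝ := fun v => if h : v ∈ S then 1 else g ⟨v, h⟩
  have hy : ∀ v, 0 < y v := by
    intro v
    by_cases h : v ∈ S
    · simp [y, h]
    · simpa [y, h] using hg ⟨v, h⟩
  have hsplit : ∀ f : V → ℝ, ∑ u, f u = ∑ u : S, f u + ∑ u : (Sᶜ : Set V), f u := fun f =>
    (Fintype.sum_subtype_add_sum_subtype (· ∈ S) f).symm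
  have hyS : ∀ u : S, y u = 1 := fun u => by simp [y]
  have hyC : ∀ u : (Sᶜ : Set V), y u = g u := fun u => by
    have : (u : V) ∉ S := u.2
    simp [y, this]
  have hcardS : (Fintype.card S : ℝ) = S.ncard := by
    rw [← Nat.card_coe_set_eq, Nat.card_eq_fintype_card]
  have hfib : ∀ c : (G.induce Sᶜ).ConnectedComponent,
      ((Finset.univ.filter fun u => (G.induce Sᶜ).connectedComponentMk u = c).card : ℝ)
        = c.supp.ncard := by
    intro c
    rw [← Set.ncard_coe_finset]
    congr 2
    ext u
    simp [ConnectedComponent.mem_supp_iff]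
  refine eigenvalue_le_of_positive G hy (fun v => ?_) hz hl
  rw [hsplit]
  simp only [hyS, hyC]
  by_cases hv : v ∈ S
  · have h1 : ∑ u : S, (if G.Adj v u then (1 : ℝ) else 0) ≤ S.ncard - 1 := by
      calc ∑ u : S, (if G.Adj v u then (1 : ℝ) else 0)
          ≤ ∑ u : S, (1 - if u = ⟨v, hv⟩ then (1 : ℝ) else 0) := by
            refine Finset.sum_le_sum fun u _ => ?_
            by_cases hu : u = ⟨v, hv⟩
            · subst hu; simp
            · simp only [hu, if_false, sub_zero]; split_ifs <;> norm_num
        _ = S.ncard - 1 := by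
            rw [Finset.sum_sub_distrib, Finset.sum_const, Finset.card_univ, nsmul_eq_mul, hcardS]
            simp
    have h2 : ∑ u : (Sᶜ : Set V), (if G.Adj v u then g u else 0) ≤
        S.ncard * ∑ c : (G.induce Sᶜ).ConnectedComponent,
          (c.supp.ncard : ℝ) / (x + 1 - c.supp.ncard) := by
      calc ∑ u : (Sᶜ : Set V), (if G.Adj v u then g u else 0) ≤ ∑ u : (Sᶜ : Set V), g u := by
            refine Finset.sum_le_sum fun u _ => ?_
            split_ifs
            · exact le_rfl
            · exact (hg u).le
        _ = ∑ c : (G.induce Sᶜ).ConnectedComponent,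
              ∑ u with (G.induce Sᶜ).connectedComponentMk u = c, g u :=
            (Finset.sum_fiberwise _ _ _).symm
        _ = _ := by
            rw [Finset.mul_sum]
            refine Finset.sum_congr rfl fun c _ => ?_
            rw [Finset.sum_congr rfl (g := fun _ => (S.ncard : ℝ) / (x + 1 - c.supp.ncard)),
              Finset.sum_const, nsmul_eq_mul, hfib]
            · ring
            · intro u hu
              rw [Finset.mem_filter] at hu
              simp only [g, hu.2]
    have h3 : y v = 1 := hyS ⟨v, hv⟩
    rw [h3]
    linarith
  · set w : (Sᶜ : Set V) := ⟨v, hv⟩ with hw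
    set c := (G.induce Sᶜ).connectedComponentMk w with hc
    have h1 : ∑ u : S, (if G.Adj v u then (1 : ℝ) else 0) ≤ S.ncard := by
      calc ∑ u : S, (if G.Adj v u then (1 : ℝ) else 0) ≤ ∑ u : S, (1 : ℝ) := by
            refine Finset.sum_le_sum fun u _ => ?_
            split_ifs <;> norm_num
        _ = S.ncard := by rw [Finset.sum_const, Finset.card_univ, nsmul_eq_mul, hcardS, mul_one]
    have h2 : ∑ u : (Sᶜ : Set V), (if G.Adj v u then g u else 0) ≤
        (c.supp.ncard - 1) * g w := by
      calc ∑ u : (Sᶜ : Set V), (if G.Adj v u then g u else 0)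
          ≤ ∑ u : (Sᶜ : Set V), ((if (G.induce Sᶜ).connectedComponentMk u = c then g w else 0) -
              if u = w then g w else 0) := by
            refine Finset.sum_le_sum fun u _ => ?_
            by_cases hu : u = w
            · subst hu; simp [hw, hc]
            · simp only [hu, if_false, sub_zero]
              by_cases ha : G.Adj v u
              · have hmk : (G.induce Sᶜ).connectedComponentMk u = c :=
                  ConnectedComponent.eq.2 (Adj.reachable (G := G.induce Sᶜ) (u := w) ha).symm
                simp only [ha, hmk, if_true, g, ← hc, le_refl]
              · rw [if_neg ha]
                split_ifs
                · exact (hg w).le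
                · exact le_rfl
        _ = (c.supp.ncard - 1) * g w := by
            rw [Finset.sum_sub_distrib, ← Finset.sum_filter, Finset.sum_const, nsmul_eq_mul, hfib]
            simp
            ring
    have h3 : y v = g w := hyC w
    have h4 : (x + 1 - c.supp.ncard) * g w = S.ncard := by
      have : x + 1 - (c.supp.ncard : ℝ) ≠ 0 := (sub_pos.2 (hx c)).ne'
      simp only [g, ← hc]
      field_simp
    rw [h3]
    linarith

/-- The function `t ↦ t / (n - 3 - t)` is convex, and it is bounded by its chord. Here `D` is a
lower bound of the denominators. -/
theorem sum_div_le {K : Type*} [Fintype K] (f : K → ℕ) (hf : ∀ c, 1 ≤ f c) {n s D : ℝ}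
    (hn : 4 < n) (hD : 0 < D) (hDn : D ≤ n - 3) (hfD : ∀ c, D ≤ n - 3 - f c)
    (hsum : ∑ c, (f c : ℝ) = n - s) (hK : s + 2 ≤ Fintype.card K) :
    ∑ c, (f c : ℝ) / (n - 3 - f c) ≤
      (s + 2) / (n - 4) + (n - 3) * (n - 2 * s - 2) / ((n - 4) * D) := by
  have h4 : 0 < n - 4 := by linarith
  have hterm : ∀ c, (f c : ℝ) / (n - 3 - f c) ≤
      1 / (n - 4) + (n - 3) * (f c - 1) / ((n - 4) * D) := by
    intro c
    have hc : 0 < n - 3 - f c := hD.trans_le (hfD c)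
    have hfc : (1 : ℝ) ≤ f c := by exact_mod_cast hf c
    have : (f c : ℝ) / (n - 3 - f c) =
        1 / (n - 4) + (n - 3) * (f c - 1) / ((n - 4) * (n - 3 - f c)) := by
      field_simp
      ring
    rw [this]
    have h1 : 0 ≤ (n - 3) * (f c - 1 : ℝ) := mul_nonneg (by linarith) (by linarith)
    have h2 := hfD c
    gcongr
  calc ∑ c, (f c : ℝ) / (n - 3 - f c)
      ≤ ∑ c, (1 / (n - 4) + (n - 3) * ((f c : ℝ) - 1) / ((n - 4) * D)) :=
        Finset.sum_le_sum fun c _ => hterm c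
    _ = Fintype.card K / (n - 4) + (n - 3) * (n - s - Fintype.card K) / ((n - 4) * D) := by
        rw [Finset.sum_add_distrib, ← Finset.sum_div, ← Finset.sum_div, ← Finset.mul_sum,
          Finset.sum_sub_distrib, hsum]
        simp
    _ ≤ (s + 2) / (n - 4) + (n - 3) * (n - 2 * s - 2) / ((n - 4) * D) := by
        have h5 : 0 < (n - 4) * D := mul_pos h4 hD
        have h6 : ((s + 2) / (n - 4) + (n - 3) * (n - 2 * s - 2) / ((n - 4) * D)) -
            (Fintype.card K / (n - 4) + (n - 3) * (n - s - Fintype.card K) / ((n - 4) * D)) =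
            (Fintype.card K - (s + 2)) * (n - 3 - D) / ((n - 4) * D) := by
          field_simp
          ring
        have h7 : 0 ≤ (Fintype.card K - (s + 2)) * (n - 3 - D) / ((n - 4) * D) :=
          div_nonneg (mul_nonneg (by linarith) (by linarith)) h5.le
        linarith

/-! ### Components of the graphs of large spectral radius -/

/-- If a cut vertex leaves exactly three components, of orders `n - 4`, `2` and `1`, then `G` is a
spanning subgraph of the extremal graph. -/
theorem exists_equiv_extremalGraph {V : Type*} [Finite V] (G : SimpleGraph V) {n : ℕ} {S : Set V}
    (hS : S.ncard = 1) {c₁ c₂ c₃ : (G.induce Sᶜ).ConnectedComponent}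
    (h₁ : c₁.supp.ncard = n - 4) (h₂ : c₂.supp.ncard = 2) (h₃ : c₃.supp.ncard = 1)
    (h₁₂ : c₁ ≠ c₂) (h₁₃ : c₁ ≠ c₃) (h₂₃ : c₂ ≠ c₃) (hall : ∀ c, c = c₁ ∨ c = c₂ ∨ c = c₃) :
    ∃ e : V ≃ Fin 1 ⊕ ((Fin (n - 4) ⊕ Fin 2) ⊕ Fin 1),
      ∀ u v, G.Adj u v → (extremalGraph n).Adj (e u) (e v) := by
  classical
  let k : (G.induce Sᶜ).ConnectedComponent → Fin 4 :=
    fun c => if c = c₁ then 1 else if c = c₂ then 2 else 3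
  let l : V → Fin 4 :=
    fun v => if h : v ∈ S then 0 else k ((G.induce Sᶜ).connectedComponentMk ⟨v, h⟩)
  have hk0 : ∀ c, k c ≠ 0 := fun c => by
    simp only [k]; split_ifs <;> decide
  have hl0 : ∀ v, l v = 0 ↔ v ∈ S := fun v => by
    by_cases h : v ∈ S
    · simp [l, h]
    · simp [l, h, hk0]
  have hlc : ∀ (c : (G.induce Sᶜ).ConnectedComponent) (i : Fin 4), i ≠ 0 →
      (∀ d, k d = i ↔ d = c) → {v | l v = i} = Subtype.val '' c.supp := by
    intro c i hi hd
    ext v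
    by_cases h : v ∈ S
    · simp [l, h, Ne.symm hi]
    · simp [l, h, hd]
  have hcard : ∀ i, Nat.card {v // l v = i} = Nat.card {p // extremalPart n p = i} := by
    have hL : ∀ i, Nat.card {v // l v = i} = {v | l v = i}.ncard :=
      fun i => Nat.card_coe_set_eq _
    have hc : ∀ c : (G.induce Sᶜ).ConnectedComponent,
        (Subtype.val '' c.supp : Set V).ncard = c.supp.ncard :=
      fun c => Set.ncard_image_of_injective _ Subtype.val_injective
    intro i
    rw [hL, Nat.card_eq_fintype_card, Fintype.card_subtype, Finset.card_filter]
    simp only [Fintype.sum_sum_type, extremalPart, Sum.elim_inl, Sum.elim_inr]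
    fin_cases i
    · have : {v | l v = 0} = S := by ext v; exact hl0 v
      simpa [this] using hS
    · have := hlc c₁ 1 (by decide) (fun d => by simp only [k]; split_ifs <;> simp_all)
      simpa [this, hc] using h₁
    · have := hlc c₂ 2 (by decide) (fun d => by simp only [k]; split_ifs <;> simp_all)
      simpa [this, hc] using h₂
    · have := hlc c₃ 3 (by decide) (fun d => by
        rcases hall d with rfl | rfl | rfl <;> simp [k, *, Ne.symm])
      simpa [this, hc] using h₃
  have hequiv : ∀ i, Nonempty ({v // l v = i} ≃ {p // extremalPart n p = i}) :=
    fun i => Finite.card_eq.1 (hcard i)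
  let e : V ≃ Fin 1 ⊕ ((Fin (n - 4) ⊕ Fin 2) ⊕ Fin 1) :=
    (Equiv.sigmaFiberEquiv l).symm.trans
      ((Equiv.sigmaCongrRight fun i => (hequiv i).some).trans
        (Equiv.sigmaFiberEquiv (extremalPart n)))
  have he : ∀ v, extremalPart n (e v) = l v := fun v => ((hequiv (l v)).some ⟨v, rfl⟩).2
  refine ⟨e, fun u v huv => ?_⟩
  rw [extremalGraph_adj, he, he, hl0, hl0]
  refine ⟨fun h => huv.ne (e.injective h), ?_⟩
  by_cases hu : u ∈ S
  · exact Or.inl hu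
  · by_cases hv : v ∈ S
    · exact Or.inr (Or.inl hv)
    · right; right
      have hadj : (G.induce Sᶜ).Adj ⟨u, hu⟩ ⟨v, hv⟩ := huv
      have := ConnectedComponent.eq.2 hadj.reachable
      simp only [l, hu, hv, dif_neg, not_false_eq_true, this]

/-- A connected graph isomorphic to a proper spanning subgraph of the extremal graph has smaller
spectral radius. -/
theorem rho_lt_of_le_extremalGraph {V : Type*} [Fintype V] {G : SimpleGraph V}
    (hG : G.Connected) {n : ℕ} (hn : 11 ≤ n) (hiso : ¬ Nonempty (G ≃g extremalGraph n))
    (e : V ≃ Fin 1 ⊕ ((Fin (n - 4) ⊕ Fin 2) ⊕ Fin 1))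
    (he : ∀ u v, G.Adj u v → (extremalGraph n).Adj (e u) (e v)) :
    G.rho < (extremalGraph n).rho := by
  classical
  obtain ⟨r, y, hr, hy, h⟩ := exists_extremalGraph_eigenvector hn
  have hnR : (11 : ℝ) ≤ n := by exact_mod_cast hn
  have hle : r ≤ (extremalGraph n).rho :=
    le_rho _ (fun h0 => (hy (Sum.inl 0)).ne' (congrFun h0 _)) fun v => by convert h v
  have hlt : G < (extremalGraph n).comap e := by
    refine lt_of_le_of_ne he ?_
    rintro rfl
    exact hiso ⟨⟨e, Iff.rfl⟩⟩
  refine lt_of_lt_of_le (rho_lt G (by linarith) fun x z hz hl => ?_) hle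
  refine eigenvalue_lt_of_lt hlt hG (y := y ∘ e) (fun v => hy _) (fun v => ?_) hz
    (fun v => by convert hl v)
  rw [Function.comp_apply, ← h (e v), ← e.sum_comp]
  exact Finset.sum_congr rfl fun u _ => by simp only [comap_adj, Function.comp_apply]

/-- For a set `S` violating the bound, `s = |S| ≥ 1` and at most `s` of the at least `s + 2`
components of `G - S` are single vertices, so all have at most `n - 2s - 2` vertices. The test
vector then shows that the spectral radius is at most `n - 4`, except if `s = 1` and some component
has `n - 4` vertices, in which case `G` is a spanning subgraph of the extremal graph. -/
theorem card_components_le_of_rho {V : Type*} [Fintype V] (G : SimpleGraph V)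
    (n : ℕ) (hn : 11 ≤ n) (hcard : Fintype.card V = n)
    (hconn : G.Connected) (hbind : G.IsBinding 1)
    (hrho : (extremalGraph n).rho ≤ G.rho)
    (hiso : ¬ Nonempty (G ≃g extremalGraph n)) (S : Set V) :
    Nat.card (G.induce Sᶜ).ConnectedComponent ≤ S.ncard + 1 := by
  classical
  by_contra! hcon
  have hfin : Finite (G.induce Sᶜ).ConnectedComponent := inferInstance
  have := Fintype.ofFinite (G.induce Sᶜ).ConnectedComponent
  set f : (G.induce Sᶜ).ConnectedComponent → ℕ := fun c => c.supp.ncard with hf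
  rw [Nat.card_eq_fintype_card] at hcon
  have hne : S.Nonempty := by
    rw [Set.nonempty_iff_ne_empty]
    rintro rfl
    have hc : (G.induce (∅ᶜ : Set V)).Connected := by
      rw [Set.compl_empty]
      exact (induceUnivIso G).connected_iff.2 hconn
    have := hc.preconnected.subsingleton_connectedComponent
    have := Fintype.card_le_one_iff_subsingleton.2 this
    omega
  have hSu : S ≠ Set.univ := by
    rintro rfl
    have hpos : 0 < Fintype.card (G.induce (Set.univᶜ : Set V)).ConnectedComponent := by omega
    obtain ⟨c⟩ := Fintype.card_pos_iff.1 hpos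
    obtain ⟨v, -⟩ := c.exists_rep
    exact v.2 trivial
  have hs1 : 1 ≤ S.ncard := (Set.ncard_pos).2 hne
  have hf1 : ∀ c, 1 ≤ f c := fun c => (Set.ncard_pos).2 c.nonempty_supp
  have hiso1 : (Finset.univ.filter fun c => f c = 1).card ≤ S.ncard := by
    have := card_isolated_components_le hbind hSu
    rwa [← Finset.coe_filter_univ, Set.ncard_coe_finset] at this
  have hsum : ∑ c, f c + S.ncard = n := by
    rw [hf, sum_ncard_supp, Nat.card_coe_set_eq, add_comm, Set.ncard_add_ncard_compl,
      Nat.card_eq_fintype_card, hcard]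
  have hrest : ∀ c, f c + 2 * (Fintype.card (G.induce Sᶜ).ConnectedComponent - 1) ≤ n := by
    intro c
    have h1 := two_mul_card_le_sum_add (Finset.univ.erase c) f hf1
    have h2 : f c + ∑ d ∈ Finset.univ.erase c, f d = ∑ d, f d :=
      Finset.add_sum_erase _ _ (Finset.mem_univ c)
    have h3 : ((Finset.univ.erase c).filter fun d => f d = 1).card ≤ S.ncard :=
      (Finset.card_le_card (Finset.filter_subset_filter _ (Finset.erase_subset _ _))).trans hiso1
    rw [Finset.card_erase_of_mem (Finset.mem_univ c), Finset.card_univ] at h1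
    omega
  have hnR : (11 : ℝ) ≤ n := by exact_mod_cast hn
  have hsumR : ∑ c, (f c : ℝ) = n - S.ncard := by
    have : ((∑ c, f c : ℕ) : ℝ) + S.ncard = n := by exact_mod_cast hsum
    push_cast at this
    linarith
  have hkR : (S.ncard : ℝ) + 2 ≤ Fintype.card (G.induce Sᶜ).ConnectedComponent := by
    exact_mod_cast hcon
  -- it suffices to bound the sum occurring for the test vector
  have hspec : ∀ D : ℝ, 0 < D → D ≤ n - 3 → (∀ c, D ≤ n - 3 - f c) →
      (S.ncard : ℝ) * ((S.ncard + 2) / (n - 4) + (n - 3) * (n - 2 * S.ncard - 2) / ((n - 4) * D))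
        ≤ n - 3 - S.ncard → False := by
    intro D hD hDn hfD hbound
    have hle := sum_div_le f hf1 (by linarith) hD hDn hfD hsumR hkR
    have hx : ((n : ℝ) - 4) + 1 = n - 3 := by ring
    have hlt : G.rho < (extremalGraph n).rho := by
      refine rho_lt G (by linarith [lt_rho_extremalGraph hn]) fun l z hz hl => ?_
      refine lt_of_le_of_lt ?_ (lt_rho_extremalGraph hn)
      refine eigenvalue_le_of_components G hne (x := n - 4) (fun c => ?_) ?_ hz
        (fun v => by convert hl v)
      · have := hfD c
        rw [hx]
        change (f c : ℝ) < _
        linarith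
      · rw [hx]
        have := mul_le_mul_of_nonneg_left hle (Nat.cast_nonneg (α := ℝ) S.ncard)
        change (S.ncard : ℝ) - 1 + S.ncard * ∑ c, (f c : ℝ) / (n - 3 - f c) ≤ n - 4
        linarith
    exact hlt.not_ge hrho
  rcases hs1.eq_or_lt with hS1 | hS2
  · by_cases hbig : ∃ c, n - 4 ≤ f c
    · -- the remaining components have three vertices in all, hence orders `2` and `1`
      obtain ⟨c₁, hc₁⟩ := hbig
      have hr := hrest c₁
      have hk : Fintype.card (G.induce Sᶜ).ConnectedComponent = 3 := by omega
      have hcard2 : (Finset.univ.erase c₁).card = 2 := by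
        rw [Finset.card_erase_of_mem (Finset.mem_univ c₁), Finset.card_univ, hk]
      obtain ⟨d, d', hdd', hd⟩ := Finset.card_eq_two.1 hcard2
      have hsum2 : f c₁ + (f d + f d') = ∑ c, f c := by
        rw [← Finset.add_sum_erase _ _ (Finset.mem_univ c₁), hd, Finset.sum_pair hdd']
      have hmem : ∀ c, c ≠ c₁ ↔ c = d ∨ c = d' := fun c => by
        have : c ∈ Finset.univ.erase c₁ ↔ c ∈ ({d, d'} : Finset _) := by rw [hd]
        simpa using this
      have hd1 : d ≠ c₁ := (hmem d).2 (Or.inl rfl)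
      have hd'1 : d' ≠ c₁ := (hmem d').2 (Or.inr rfl)
      have hall : ∀ c, c = c₁ ∨ c = d ∨ c = d' := fun c => by
        by_cases h : c = c₁
        · exact Or.inl h
        · exact Or.inr ((hmem c).1 h)
      have hfd := hf1 d
      have hfd' := hf1 d'
      have hone : ¬ (f d = 1 ∧ f d' = 1) := by
        rintro ⟨h, h'⟩
        have : ({d, d'} : Finset _) ⊆ Finset.univ.filter fun c => f c = 1 := by
          intro c hc
          simp only [Finset.mem_insert, Finset.mem_singleton] at hc
          rcases hc with rfl | rfl <;> simp [h, h']
        have := Finset.card_le_card this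
        rw [Finset.card_pair hdd'] at this
        omega
      have hfc₁ : f c₁ = n - 4 := by omega
      have hex : ∃ e : V ≃ Fin 1 ⊕ ((Fin (n - 4) ⊕ Fin 2) ⊕ Fin 1),
          ∀ u v, G.Adj u v → (extremalGraph n).Adj (e u) (e v) := by
        by_cases h2 : f d = 2
        · exact exists_equiv_extremalGraph G hS1.symm hfc₁ h2 (show f d' = 1 by omega) hd1.symm
            hd'1.symm hdd' hall
        · exact exists_equiv_extremalGraph G hS1.symm hfc₁ (show f d' = 2 by omega)
            (show f d = 1 by omega) hd'1.symm hd1.symm hdd'.symm fun c => (hall c).imp_right Or.symm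
      obtain ⟨e, he⟩ := hex
      exact (rho_lt_of_le_extremalGraph hconn hn hiso e he).not_ge hrho
    · push Not at hbig
      refine hspec 2 two_pos (by linarith) (fun c => ?_) ?_
      · have h := hbig c
        have : f c + 5 ≤ n := by omega
        have : (f c : ℝ) + 5 ≤ n := by exact_mod_cast this
        linarith
      · rw [← hS1, Nat.cast_one]
        have h4 : (0 : ℝ) < n - 4 := by linarith
        rw [show (1 : ℝ) * ((1 + 2) / (n - 4) + (n - 3) * (n - 2 * 1 - 2) / ((n - 4) * 2)) =
          3 / (n - 4) + (n - 3) / 2 by field_simp; ring]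
        have : (3 : ℝ) / (n - 4) ≤ 1 := (div_le_one h4).2 (by linarith)
        linarith
  · have hn2 : 2 * S.ncard + 4 ≤ n := by
      obtain ⟨c, hc⟩ : ∃ c, f c ≠ 1 := by
        by_contra! h
        rw [Finset.filter_true_of_mem fun c _ => h c, Finset.card_univ] at hiso1
        omega
      have := hrest c
      have := hf1 c
      omega
    have hs2R : (2 : ℝ) ≤ S.ncard := by exact_mod_cast hS2
    have hn2R : 2 * (S.ncard : ℝ) + 4 ≤ n := by exact_mod_cast hn2
    refine hspec (2 * S.ncard - 1) (by linarith) (by linarith) (fun c => ?_) ?_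
    · have : f c + 2 * S.ncard + 2 ≤ n := by
        have := hrest c
        omega
      have : (f c : ℝ) + 2 * S.ncard + 2 ≤ n := by exact_mod_cast this
      linarith
    · have h4 : (0 : ℝ) < n - 4 := by linarith
      have hD : (0 : ℝ) < 2 * S.ncard - 1 := by linarith
      set s := (S.ncard : ℝ) with hs
      rw [show s * ((s + 2) / (n - 4) + (n - 3) * (n - 2 * s - 2) / ((n - 4) * (2 * s - 1))) =
        s * ((s + 2) * (2 * s - 1) + (n - 3) * (n - 2 * s - 2)) / ((n - 4) * (2 * s - 1)) by
          have hD' : s * 2 - 1 ≠ 0 := by linarith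
          field_simp]
      rw [div_le_iff₀ (mul_pos h4 hD)]
      -- with `m = n - 2s - 4`, the difference of the two sides is
      -- `2s³ - 5s² - 2s + (4s² - 4s - 1) m + (s - 1) m²`
      obtain ⟨m, hm⟩ : ∃ m : ℝ, (n : ℝ) = 2 * s + 4 + m := ⟨n - 2 * s - 4, by ring⟩
      have hm0 : 0 ≤ m := by linarith
      have hkey : 0 ≤ 2 * s ^ 3 - 5 * s ^ 2 - 2 * s + (4 * s ^ 2 - 4 * s - 1) * m
          + (s - 1) * m ^ 2 := by
        have h1 : 0 ≤ (s - 1) * m ^ 2 := mul_nonneg (by linarith) (sq_nonneg m)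
        rcases (Nat.succ_le_of_lt hS2).eq_or_lt with h | h
        · have : s = 2 := by rw [hs, ← h]; norm_num
          rw [this] at hm h1 ⊢
          nlinarith
        · have hs3 : (3 : ℝ) ≤ s := by rw [hs]; exact_mod_cast h
          have h2 : 0 ≤ (4 * s ^ 2 - 4 * s - 1) * m := mul_nonneg (by nlinarith) hm0
          have h3 : 0 ≤ s * (2 * s ^ 2 - 5 * s - 2) := mul_nonneg (by linarith) (by nlinarith)
          nlinarith
      rw [hm]
      nlinarith

end SimpleGraph

theorem theorem1p2 {V : Type*} [Fintype V] (G : SimpleGraph V)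
    (n : ℕ) (hn : 11 ≤ n) (hcard : Fintype.card V = n)
    (hconn : G.Connected) (hbind : G.IsBinding 1)
    (hrho : (SimpleGraph.extremalGraph n).rho ≤ G.rho) :
    (∀ H : V → Set ℕ, (∀ v, H v = {1} ∨ H v = {0, 2}) → Even {v | H v = {1}}.ncard →
        ∃ F : SimpleGraph V, G.IsHFactor H F) ↔
      ¬ Nonempty (G ≃g SimpleGraph.extremalGraph n) := by
  constructor
  · rintro h ⟨e⟩
    obtain ⟨H, hH, heven, hF⟩ := G.exists_not_isHFactor_of_iso n (by omega) e
    obtain ⟨F, hFH⟩ := h H hH heven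
    exact hF F hFH
  · intro hiso
    exact G.exists_isHFactor_of_card_components_le
      (G.card_components_le_of_rho n hn hcard hconn hbind hrho hiso)
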